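/- For $p=(p_1,p_2)$ and $q=(q_1,q_2)$ in $\mathbb N^2$ (with $0\in\mathbb N$), say that $p$ properly divides $q$ if for each $i\in\{1,2\}$ either $p_i=q_i=0$ or $p_i<q_i$, and write $p\le q$ if $p=q$ or $p$ properly divides $q$. For $a\in\mathbb N$ let $P(a,a)=\{p\in\mathbb N^2 : p\le (a,a)\}$, partially ordered by $\le$; its least element is $(0,0)$ and its greatest element is $(a,a)$. Let $\Delta(P(a,a))$ be its order complex, that is, the simplicial complex of all finite chains in $P(a,a)\setminus\{(0,0),(a,a)\}$, and let $$\widetilde\chi(\Delta(P(a,a)))=\sum_{i\ge 0}(-1)^i\,\mathrm{rank}\,\widetilde H_i(\Delta(P(a,a));\mathbb Z)$$ be its reduced Euler characteristic, where $\widetilde H_i$ denotes reduced simplicial homology. Let $a\ge 2$. If $a$ is odd, then $\widetilde\chi(\Delta(P(a,a)))=0$. If $a$ is even, then $$\widetilde\chi(\Delta(P(a,a)))=(-1)^{\frac{a-2}{2}}\cdot 2\binom{a-2}{\frac{a-2}{2}}.$$ -/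

import Mathlib

namespace ProperDivision

/-- Exponent vectors `(x, y) ∈ ℕ²`, i.e. monomials in two variables.  This is a type of its own,
rather than `ℕ × ℕ`, because it carries the order by proper divisibility and not the
componentwise order. -/
@[ext]
structure Exponent where
  /-- the first exponent -/
  fst : ℕ
  /-- the second exponent -/
  snd : ℕ

/-- `p` properly divides `q`: in each coordinate, either both exponents vanish or the exponent of
`p` is strictly smaller than that of `q`. -/
def ProperlyDivides (p q : Exponent) : Prop :=
  ((p.fst = 0 ∧ q.fst = 0) ∨ p.fst < q.fst) ∧ ((p.snd = 0 ∧ q.snd = 0) ∨ p.snd < q.snd)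

/-- The order by proper divisibility: `p ≤ q` iff `p = q` or `p` properly divides `q`. -/
instance : PartialOrder Exponent where
  le p q := p = q ∨ ProperlyDivides p q
  le_refl _ := Or.inl rfl
  le_trans p q r := by
    rintro (rfl | hpq) (rfl | hqr)
    · exact Or.inl rfl
    · exact Or.inr hqr
    · exact Or.inr hpq
    · right
      unfold ProperlyDivides at *
      omega
  le_antisymm p q := by
    rintro (rfl | hpq) (h | hqp)
    · rfl
    · rfl
    · exact h.symm
    · unfold ProperlyDivides at *
      ext <;> omega

/-- The zero vector is the least element for proper divisibility. -/
instance : OrderBot Exponent where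
  bot := ⟨0, 0⟩
  bot_le p := by
    right
    change ((0 = 0 ∧ p.fst = 0) ∨ 0 < p.fst) ∧ ((0 = 0 ∧ p.snd = 0) ∨ 0 < p.snd)
    omega

/-- The poset `P(a, b)` of all exponent vectors that are `≤ (a, b)` for proper divisibility, with
the induced order.  Its least element is `(0, 0)` and its greatest element is `(a, b)`. -/
abbrev P (a b : ℕ) : Type := Set.Iic (⟨a, b⟩ : Exponent)

instance instFiniteP (a b : ℕ) : Finite (P a b) := by
  refine Finite.of_injective
    (fun p : P a b => ((⟨p.1.fst, ?_⟩, ⟨p.1.snd, ?_⟩) : Fin (a + 1) × Fin (b + 1))) ?_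
  · rcases p.2 with h | h
    · rw [h]; simp
    · have h1 := h.1
      simp only at h1
      omega
  · rcases p.2 with h | h
    · rw [h]; simp
    · have h1 := h.2
      simp only at h1
      omega
  · intro p q h
    simp only [Prod.mk.injEq, Fin.mk.injEq] at h
    exact Subtype.ext (Exponent.ext h.1 h.2)

section OrderComplex

variable (Q : Type*) [PartialOrder Q] [BoundedOrder Q]

/-- The order complex `Δ(Q)` of a bounded poset `Q`: its faces are the nonempty finite chains of
`Q` that contain neither the least nor the greatest element of `Q`.  (Following Mathlib, the empty
face is not listed; it is put back in `AugmentedFace`.) -/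
def orderComplex : PreAbstractSimplicialComplex Q where
  faces := {s | s.Nonempty ∧ IsChain (· ≤ ·) (s : Set Q) ∧ ⊥ ∉ s ∧ ⊤ ∉ s}
  isRelLowerSet_faces := by
    rintro s ⟨hne, hc, hb, ht⟩
    refine ⟨hne, fun t hts hne' => ⟨hne', hc.mono (by exact_mod_cast hts), ?_, ?_⟩⟩
    · exact fun h => hb (hts h)
    · exact fun h => ht (hts h)

/-- The faces of `Δ(Q)` with `k` vertices (dimension `k - 1`), where the empty face is allowed. -/
def AugmentedFace (k : ℕ) : Type _ :=
  {s : Finset Q // (s = ∅ ∨ s ∈ orderComplex Q) ∧ s.card = k}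

/-- The free abelian group on the faces of `Δ(Q)` with `k` vertices, i.e. the group of simplicial
`(k - 1)`-chains; for `k = 0` it is the copy of `ℤ` spanned by the empty face. -/
abbrev AugmentedChains (k : ℕ) : Type _ := AugmentedFace Q k →₀ ℤ

variable {Q}

open Classical in
/-- The face obtained from `s` by deleting the vertex `x`. -/
noncomputable def AugmentedFace.delete {k : ℕ} (s : AugmentedFace Q (k + 1)) (x : Q)
    (hx : x ∈ s.1) : AugmentedFace Q k :=
  ⟨s.1.erase x, by
    constructor
    · rcases s.2.1 with h | h
      · rw [h] at hx; simp at hx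
      · rcases (s.1.erase x).eq_empty_or_nonempty with h0 | h0
        · exact Or.inl h0
        · exact Or.inr (((orderComplex Q).isRelLowerSet_faces h).2 (s.1.erase_subset x) h0)
    · rw [Finset.card_erase_of_mem hx, s.2.2]; rfl⟩

open Classical in
/-- The position of the vertex `x` in the chain `s`, counted from `0`. -/
noncomputable def AugmentedFace.position {k : ℕ} (s : AugmentedFace Q k) (x : Q) : ℕ :=
  (s.1.filter (· < x)).card

variable (Q)

/-- The simplicial boundary map, each face being oriented by the order of `Q`:
`∂ {x₀ < ⋯ < x_k} = ∑ j, (-1)^j {x₀ < ⋯ < x_k} \ {x_j}`.  For `k = 0` it is the augmentation, which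
sends each vertex to the empty face. -/
noncomputable def boundary (k : ℕ) : AugmentedChains Q (k + 1) →ₗ[ℤ] AugmentedChains Q k :=
  Finsupp.linearCombination ℤ fun s =>
    ∑ x ∈ s.1.attach, (-1 : ℤ) ^ s.position x.1 • Finsupp.single (s.delete x.1 x.2) 1

/-- The `i`-th reduced simplicial homology group `H̃_i(Δ(Q); ℤ)`, `i ≥ 0`: the kernel of
`∂ : C_i → C_{i-1}` modulo the image of `∂ : C_{i+1} → C_i`. -/
abbrev ReducedHomology (i : ℕ) : Type _ :=
  LinearMap.ker (boundary Q i) ⧸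
    (LinearMap.range (boundary Q (i + 1))).submoduleOf (LinearMap.ker (boundary Q i))

/-- The reduced Euler characteristic `χ̃(Δ(Q)) = ∑_{i ≥ 0} (-1)^i rank H̃_i(Δ(Q); ℤ)`, for a finite
bounded poset `Q` whose order complex is nonempty (so that there is no homology in degree `-1`).
The sum has only finitely many nonzero terms, see `finite_support_reducedEulerChar`. -/
noncomputable def reducedEulerChar : ℤ :=
  ∑ᶠ i : ℕ, (-1 : ℤ) ^ i * (Module.finrank ℤ (ReducedHomology Q i) : ℤ)

/-- Consecutive boundary maps compose to zero. -/
theorem boundary_comp_boundary (k : ℕ) : boundary Q k ∘ₗ boundary Q (k + 1) = 0 := by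
  classical
  refine Finsupp.lhom_ext' fun s => LinearMap.ext_ring ?_
  have hcmp : ∀ x ∈ s.1, ∀ y ∈ s.1, x ≠ y → x < y ∨ y < x := by
    intro x hx y hy hxy
    rcases s.2.1 with h | h
    · rw [h] at hx; simp at hx
    · rcases h.2.1 hx hy hxy with h' | h'
      · exact Or.inl (lt_of_le_of_ne h' hxy)
      · exact Or.inr (lt_of_le_of_ne h' hxy.symm)
  have hpos : ∀ x (hx : x ∈ s.1) y, y ∈ s.1 → x < y →
      (s.delete x hx).position y + 1 = s.position y ∧
      ∀ hy : y ∈ s.1, (s.delete y hy).position x = s.position x := by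
    intro x hx y _ hxy
    constructor
    · have : (s.delete x hx).1.filter (· < y) = (s.1.filter (· < y)).erase x :=
        Finset.filter_erase _ _ _
      unfold AugmentedFace.position
      rw [this, Finset.card_erase_add_one]
      simp [hx, hxy]
    · intro hy
      have : (s.delete y hy).1.filter (· < x) = (s.1.filter (· < x)).erase y :=
        Finset.filter_erase _ _ _
      unfold AugmentedFace.position
      rw [this, Finset.erase_eq_of_notMem]
      simp [not_lt_of_ge hxy.le]
  simp only [boundary, LinearMap.coe_comp, Function.comp_apply, Finsupp.lsingle_apply,
    Finsupp.linearCombination_single, one_smul, map_sum, map_smul, LinearMap.zero_apply,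
    LinearMap.zero_comp]
  simp only [Finset.smul_sum, smul_smul]
  rw [Finset.sum_sigma']
  have hmem : ∀ p : (x : {x // x ∈ s.1}) × {y // y ∈ (s.delete x.1 x.2).1},
      p.2.1 ∈ s.1 ∧ p.2.1 ≠ p.1.1 := fun p =>
    ⟨Finset.mem_of_mem_erase p.2.2, Finset.ne_of_mem_erase p.2.2⟩
  refine Finset.sum_involution
    (fun p _ => ⟨⟨p.2.1, (hmem p).1⟩, ⟨p.1.1, Finset.mem_erase.2 ⟨(hmem p).2.symm, p.1.2⟩⟩⟩)
    ?_ ?_ ?_ ?_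
  · rintro ⟨⟨x, hx⟩, ⟨y, hy⟩⟩ -
    have hy' := Finset.mem_of_mem_erase hy
    have hne := Finset.ne_of_mem_erase hy
    have hdel : ∀ h1, (s.delete x hx).delete y hy = (s.delete y hy').delete x h1 :=
      fun _ => Subtype.ext (Finset.erase_right_comm)
    simp only
    rw [hdel (Finset.mem_erase.2 ⟨hne.symm, hx⟩), ← add_smul]
    convert zero_smul ℤ _
    rcases hcmp x hx y hy' hne.symm with h | h
    · obtain ⟨e1, e2⟩ := hpos x hx y hy' h
      rw [e2 hy', ← e1]; ring
    · obtain ⟨e1, e2⟩ := hpos y hy' x hx h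
      rw [e2 hx, ← e1]; ring
  · rintro p - - h
    exact (hmem p).2 (congrArg (fun q => q.1.1) h)
  · intro p _; simp
  · rintro p -; rfl

/-- For finite `Q` only finitely many terms of `reducedEulerChar` are nonzero. -/
theorem finite_support_reducedEulerChar [Finite Q] :
    (Function.support fun i : ℕ =>
      (-1 : ℤ) ^ i * (Module.finrank ℤ (ReducedHomology Q i) : ℤ)).Finite := by
  classical
  have := Fintype.ofFinite Q
  refine (Finset.range (Fintype.card Q)).finite_toSet.subset fun i hi => ?_
  by_contra hlt
  have hE : IsEmpty (AugmentedFace Q (i + 1)) := ⟨fun s => by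
    have h1 := s.2.2
    have h2 := s.1.card_le_univ
    simp only [Finset.coe_range, Set.mem_Iio] at hlt
    omega⟩
  apply hi
  have : Subsingleton (ReducedHomology Q i) := inferInstance
  simp [Module.finrank_zero_of_subsingleton]

end OrderComplex

end ProperDivision

/-! By Euler–Poincaré (`reducedEulerChar_eq_openChainSum`), the reduced Euler characteristic is the
alternating count of chains strictly between bottom and top. Splitting chains by their greatest
element (`openChainSum_eq`) shows that this count obeys the recursion of the Möbius function μ from
the bottom.

For `i, j ≥ 1` the elements strictly below `(i, j)` form the full rectangle `[0, i) × [0, j)`, so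
the recursion only involves rectangle sums. These are solved in closed form by `moebiusBot`, by
means of `sum_altChooseSum`. On the diagonal the closed form is twice a coefficient of `(1 - X ^ 2)
^ n` (`altChooseSum_self`), which vanishes for odd `n`. -/

namespace ProperDivision

/-! ### Recursion for alternating chain counts -/

section ChainSum

variable {Q : Type*} [PartialOrder Q] [OrderBot Q] [Fintype Q]

open Classical in
/-- The chains of the open interval `(⊥, q)`, the empty chain included. -/
noncomputable def openChains (q : Q) : Finset (Finset Q) :=
  Finset.univ.filter fun s => IsChain (· ≤ ·) (s : Set Q) ∧ ∀ x ∈ s, x ≠ ⊥ ∧ x < q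

/-- The alternating count of the chains of the open interval `(⊥, q)` by dimension. -/
noncomputable def openChainSum (q : Q) : ℤ :=
  ∑ s ∈ openChains q, (-1 : ℤ) ^ (s.card + 1)

theorem mem_openChains {q : Q} {s : Finset Q} :
    s ∈ openChains q ↔ IsChain (· ≤ ·) (s : Set Q) ∧ ∀ x ∈ s, x ≠ ⊥ ∧ x < q := by
  simp [openChains]

open Classical in
/-- Splitting the nonempty chains by their greatest element. -/
theorem openChainSum_eq (q : Q) :
    openChainSum q =
      -(1 + ∑ p ∈ Finset.univ.filter (fun p : Q => p ≠ ⊥ ∧ p < q), openChainSum p) := by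
  have h0 : (∅ : Finset Q) ∈ openChains q := by simp [mem_openChains]
  rw [openChainSum, ← Finset.add_sum_erase _ _ h0, neg_add, ← Finset.sum_neg_distrib]
  congr 1
  simp only [openChainSum, ← Finset.sum_neg_distrib]
  rw [Finset.sum_sigma']
  symm
  refine Finset.sum_nbij (fun a => insert a.1 a.2) ?_ ?_ ?_ ?_
  · rintro ⟨p, s⟩ h
    simp only [Finset.mem_sigma, Finset.mem_filter, Finset.mem_univ, true_and, mem_openChains] at h
    obtain ⟨⟨hp, hpq⟩, hc, hs⟩ := h
    refine Finset.mem_erase.2 ⟨Finset.insert_ne_empty _ _, mem_openChains.2 ⟨?_, ?_⟩⟩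
    · rw [Finset.coe_insert]
      exact hc.insert fun b hb _ => Or.inr (hs b hb).2.le
    · intro x hx
      rcases Finset.mem_insert.1 hx with rfl | hx
      · exact ⟨hp, hpq⟩
      · exact ⟨(hs x hx).1, (hs x hx).2.trans hpq⟩
  · rintro ⟨p, s⟩ h ⟨p', s'⟩ h' e
    simp only [Finset.coe_sigma, Set.mem_sigma_iff, Finset.mem_coe, mem_openChains] at h h'
    simp only at e
    -- The added vertex is the greatest element of the enlarged chain, so the chain determines it.
    have hle : ∀ {p p' : Q} {s s' : Finset Q}, (∀ x ∈ s', x ≠ ⊥ ∧ x < p') →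
        insert p s = insert p' s' → p ≤ p' := by
      intro p p' s s' hs e
      have : p ∈ insert p' s' := e ▸ Finset.mem_insert_self p s
      rcases Finset.mem_insert.1 this with rfl | hx
      · exact le_rfl
      · exact (hs p hx).2.le
    obtain rfl : p = p' := le_antisymm (hle h'.2.2 e) (hle h.2.2 e.symm)
    have h1 : p ∉ s := fun hp => lt_irrefl _ (h.2.2 p hp).2
    have h2 : p ∉ s' := fun hp => lt_irrefl _ (h'.2.2 p hp).2
    rw [← Finset.erase_insert h1, ← Finset.erase_insert h2, e]
  · intro s hs
    rw [Finset.mem_coe, Finset.mem_erase, mem_openChains] at hs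
    obtain ⟨hne, hc, hs⟩ := hs
    obtain ⟨p, hp⟩ := s.exists_maximal (Finset.nonempty_iff_ne_empty.2 hne)
    refine ⟨⟨p, s.erase p⟩, ?_, Finset.insert_erase hp.1⟩
    simp only [Finset.coe_sigma, Set.mem_sigma_iff, Finset.mem_coe, mem_openChains,
      Finset.mem_filter, Finset.mem_univ, true_and]
    refine ⟨hs p hp.1, hc.mono (by exact_mod_cast Finset.erase_subset _ _), fun x hx => ?_⟩
    obtain ⟨hxp, hx⟩ := Finset.mem_erase.1 hx
    refine ⟨(hs x hx).1, lt_of_le_of_ne ?_ hxp⟩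
    rcases hc hx hp.1 hxp with h | h
    · exact h
    · exact hp.2 hx h
  · rintro ⟨p, s⟩ h
    simp only [Finset.mem_sigma, mem_openChains] at h
    have h1 : p ∉ s := fun hp => lt_irrefl _ (h.2.2 p hp).2
    rw [Finset.card_insert_of_notMem h1]
    ring

end ChainSum

/-! ### The Euler–Poincaré formula -/

section EulerPoincare

variable (Q : Type*) [PartialOrder Q] [BoundedOrder Q]

noncomputable instance [Fintype Q] (k : ℕ) : Fintype (AugmentedFace Q k) := by
  classical
  unfold AugmentedFace
  infer_instance

theorem mem_openChains_top [Fintype Q] [Nontrivial Q] {s : Finset Q} :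
    s ∈ openChains (⊤ : Q) ↔ s = ∅ ∨ s ∈ orderComplex Q := by
  have hQ : s ∈ orderComplex Q ↔
      s.Nonempty ∧ IsChain (· ≤ ·) (s : Set Q) ∧ ⊥ ∉ s ∧ ⊤ ∉ s := Iff.rfl
  rw [mem_openChains, hQ]
  rcases s.eq_empty_or_nonempty with rfl | hne
  · simp
  · simp only [hne.ne_empty, hne, false_or, true_and, lt_top_iff_ne_top]
    refine and_congr_right fun _ => ⟨fun h => ⟨fun hb => (h _ hb).1 rfl, fun ht => (h _ ht).2 rfl⟩,
      fun h x hx => ⟨?_, ?_⟩⟩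
    · rintro rfl; exact h.1 hx
    · rintro rfl; exact h.2 hx

theorem card_augmentedFace [Fintype Q] [Nontrivial Q] (k : ℕ) :
    Fintype.card (AugmentedFace Q k) = ((openChains (⊤ : Q)).filter (·.card = k)).card := by
  classical
  rw [← Fintype.card_coe]
  exact Fintype.card_congr (Equiv.subtypeEquivRight fun s => by
    rw [Finset.mem_filter, mem_openChains_top])

theorem openChainSum_top [Fintype Q] [Nontrivial Q] :
    openChainSum (⊤ : Q) = ∑ k ∈ Finset.range (Fintype.card Q + 1),
      (-1 : ℤ) ^ (k + 1) * (Fintype.card (AugmentedFace Q k) : ℤ) := by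
  classical
  rw [openChainSum, ← Finset.sum_fiberwise_of_maps_to
    (g := Finset.card) (t := Finset.range (Fintype.card Q + 1))
    (fun s _ => Finset.mem_range.2 (Nat.lt_succ_of_le s.card_le_univ))]
  refine Finset.sum_congr rfl fun k _ => ?_
  rw [card_augmentedFace, Finset.sum_congr rfl (g := fun _ => (-1 : ℤ) ^ (k + 1)),
    Finset.sum_const, nsmul_eq_mul, mul_comm]
  intro s hs
  rw [(Finset.mem_filter.1 hs).2]

/-- Rank–nullity over ℤ, used twice: for the kernel modulo the boundaries, and for the chain group
modulo the kernel. -/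
theorem finrank_reducedHomology [Fintype Q] (i : ℕ) :
    (Module.finrank ℤ (ReducedHomology Q i) : ℤ) =
      Fintype.card (AugmentedFace Q (i + 1)) - Module.finrank ℤ (LinearMap.range (boundary Q i))
        - Module.finrank ℤ (LinearMap.range (boundary Q (i + 1))) := by
  have hle : LinearMap.range (boundary Q (i + 1)) ≤ LinearMap.ker (boundary Q i) :=
    LinearMap.range_le_ker_iff.2 (boundary_comp_boundary Q i)
  have h1 := Submodule.finrank_quotient_add_finrank
    ((LinearMap.range (boundary Q (i + 1))).submoduleOf (LinearMap.ker (boundary Q i)))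
  rw [(Submodule.submoduleOfEquivOfLe hle).finrank_eq] at h1
  have h2 := Submodule.finrank_quotient_add_finrank (LinearMap.ker (boundary Q i))
  rw [(boundary Q i).quotKerEquivRange.finrank_eq, Module.finrank_finsupp_self] at h2
  change Module.finrank ℤ (ReducedHomology Q i) + _ = _ at h1
  omega

/-- Any vertex has the empty face as its boundary. Hence there is no homology in degree -1, and this
boundary map has rank one. -/
theorem range_boundary_zero (h : ∃ x : Q, x ≠ ⊥ ∧ x ≠ ⊤) :
    LinearMap.range (boundary Q 0) = ⊤ := by
  classical
  obtain ⟨x, hb, ht⟩ := h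
  have hsub : Subsingleton (AugmentedFace Q 0) := ⟨fun s t => Subtype.ext <| by
    rw [Finset.card_eq_zero.1 s.2.2, Finset.card_eq_zero.1 t.2.2]⟩
  let e : AugmentedFace Q 0 := ⟨∅, Or.inl rfl, rfl⟩
  let v : AugmentedFace Q 1 := ⟨{x}, Or.inr ⟨Finset.singleton_nonempty x, by simp,
    by simpa using hb.symm, by simpa using ht.symm⟩, Finset.card_singleton x⟩
  have hpos : v.position x = 0 := by simp [AugmentedFace.position, v]
  have hv : boundary Q 0 (Finsupp.single v 1) = Finsupp.single e 1 := by
    rw [boundary, Finsupp.linearCombination_single, one_smul]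
    have : ∀ y ∈ v.1.attach, (-1 : ℤ) ^ v.position y.1 • Finsupp.single (v.delete y.1 y.2) (1 : ℤ) =
        Finsupp.single e 1 := by
      rintro ⟨y, hy⟩ -
      obtain rfl : y = x := Finset.mem_singleton.1 hy
      rw [hpos, pow_zero, one_smul, Subsingleton.elim (v.delete y hy) e]
    rw [Finset.sum_congr rfl this, Finset.sum_const, Finset.card_attach, v.2.2, one_smul]
  refine LinearMap.range_eq_top.2 fun f => ⟨f e • Finsupp.single v 1, ?_⟩
  rw [map_smul, hv]
  ext s
  rw [Subsingleton.elim s e]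
  simp

/-- The Euler-Poincaré formula for the reduced Euler characteristic. -/
theorem reducedEulerChar_eq_openChainSum [Fintype Q] (h : ∃ x : Q, x ≠ ⊥ ∧ x ≠ ⊤) :
    reducedEulerChar Q = openChainSum (⊤ : Q) := by
  classical
  have : Nontrivial Q := ⟨_, _, h.choose_spec.1⟩
  set r : ℕ → ℤ := fun k => Module.finrank ℤ (LinearMap.range (boundary Q k))
  set N := Fintype.card Q
  have hE : ∀ k, N < k → IsEmpty (AugmentedFace Q k) := fun k hk => ⟨fun s => by
    have h1 := s.2.2
    have h2 := s.1.card_le_univ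
    omega⟩
  have hc0 : Fintype.card (AugmentedFace Q 0) = 1 := by
    rw [Fintype.card_eq_one_iff]
    exact ⟨⟨∅, Or.inl rfl, rfl⟩, fun s => Subtype.ext (Finset.card_eq_zero.1 s.2.2)⟩
  have hr0 : r 0 = 1 := by
    change ((Module.finrank ℤ (LinearMap.range (boundary Q 0)) : ℕ) : ℤ) = 1
    rw [range_boundary_zero Q h, finrank_top, Module.finrank_finsupp_self, hc0, Nat.cast_one]
  have hrN : r N = 0 := by
    have := hE (N + 1) (Nat.lt_succ_self N)
    have h0 : boundary Q N = 0 := LinearMap.ext fun f => by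
      rw [Subsingleton.elim f 0, map_zero, map_zero]
    change ((Module.finrank ℤ (LinearMap.range (boundary Q N)) : ℕ) : ℤ) = 0
    rw [h0, LinearMap.range_zero, finrank_bot, Nat.cast_zero]
  have hsupp : reducedEulerChar Q = ∑ i ∈ Finset.range N,
      (-1 : ℤ) ^ i * (Module.finrank ℤ (ReducedHomology Q i) : ℤ) := by
    refine finsum_eq_sum_of_support_subset _ fun i hi => ?_
    by_contra hlt
    have := hE (i + 1) (by simpa [Nat.lt_succ_iff] using hlt)
    apply hi
    have : Subsingleton (ReducedHomology Q i) := inferInstance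
    simp [Module.finrank_zero_of_subsingleton]
  -- Each boundary rank enters two consecutive homology ranks and cancels. The surviving `r 0 = 1`
  -- accounts for the empty chain.
  have htel : ∀ n : ℕ, ∑ i ∈ Finset.range n, (-1 : ℤ) ^ i * (r i + r (i + 1)) =
      r 0 - (-1) ^ n * r n := by
    intro n
    induction n with
    | zero => simp
    | succ n ih => rw [Finset.sum_range_succ, ih]; ring
  rw [hsupp, openChainSum_top, Finset.sum_range_succ', hc0]
  have hterm : ∀ i, (-1 : ℤ) ^ i * (Module.finrank ℤ (ReducedHomology Q i) : ℤ) =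
      (-1) ^ (i + 1 + 1) * (Fintype.card (AugmentedFace Q (i + 1)) : ℤ) -
        (-1) ^ i * (r i + r (i + 1)) := fun i => by
    rw [finrank_reducedHomology]
    ring
  rw [Finset.sum_congr rfl fun i _ => hterm i, Finset.sum_sub_distrib, htel, hr0, hrN]
  simp [sub_eq_add_neg, N]

end EulerPoincare
-- Alternating sums of products of binomial coefficients
/-- The coefficient of `x ^ i * y ^ j` in `1 / (1 - x - y + 2 * x * y)`. -/
def altChooseSum (i j : ℕ) : ℤ :=
  ∑ k ∈ Finset.range (i + 1), (-1 : ℤ) ^ k * (i.choose k * j.choose k)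

theorem altChooseSum_eq_sum_range {i j N : ℕ} (h : i < N) :
    altChooseSum i j = ∑ k ∈ Finset.range N, (-1 : ℤ) ^ k * (i.choose k * j.choose k) := by
  refine Finset.sum_subset (Finset.range_subset_range.2 h) fun k _ hk => ?_
  rw [Nat.choose_eq_zero_of_lt (by simpa using hk)]
  simp

theorem sum_range_choose_right (n k : ℕ) :
    ∑ i ∈ Finset.range n, (i.choose k : ℤ) = n.choose (k + 1) := by
  induction n with
  | zero => simp
  | succ n ih => rw [Finset.sum_range_succ, ih, Nat.choose_succ_succ]; push_cast; ring

/-- The hockey-stick identity in both variables shifts `k` to `k + 1`, which flips the sign; the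
missing term `k = 0` is the 1. -/
theorem sum_altChooseSum (m n : ℕ) :
    ∑ i ∈ Finset.range m, ∑ j ∈ Finset.range n, altChooseSum i j = 1 - altChooseSum m n := by
  have h1 : ∀ i ∈ Finset.range m, ∑ j ∈ Finset.range n, altChooseSum i j =
      -- The range of `k` is made independent of `i` so that the sums over `i` and `k` can be
      -- swapped.
      ∑ k ∈ Finset.range m, (-1 : ℤ) ^ k * (i.choose k * n.choose (k + 1)) := by
    intro i hi
    simp only [altChooseSum_eq_sum_range (Finset.mem_range.1 hi)]
    rw [Finset.sum_comm]
    simp only [← Finset.mul_sum, sum_range_choose_right]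
  rw [Finset.sum_congr rfl h1, Finset.sum_comm, altChooseSum, Finset.sum_range_succ']
  simp only [← Finset.mul_sum, ← Finset.sum_mul, sum_range_choose_right, pow_succ]
  simp

-- By the symmetry of binomial coefficients, the sum is the coefficient of `X ^ n` in `(1 - X) ^ n *
-- (1 + X) ^ n = (1 - X ^ 2) ^ n`.
open Polynomial in
theorem altChooseSum_self (n : ℕ) :
    altChooseSum n n = if Even n then (-1 : ℤ) ^ (n / 2) * n.choose (n / 2) else 0 := by
  have hneg : ∀ k, ((1 - X : ℤ[X]) ^ n).coeff k = (-1) ^ k * n.choose k := by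
    intro k
    have : (1 - X : ℤ[X]) ^ n = ((1 + X) ^ n).comp (C (-1) * X) := by simp [sub_eq_add_neg]
    rw [this, comp_C_mul_X_coeff, coeff_one_add_X_pow, mul_comm]
  have h1 : altChooseSum n n = ((1 - X : ℤ[X]) ^ n * (1 + X) ^ n).coeff n := by
    rw [coeff_mul, Finset.Nat.sum_antidiagonal_eq_sum_range_succ_mk, altChooseSum]
    refine Finset.sum_congr rfl fun k hk => ?_
    have hk : k ≤ n := Nat.lt_succ_iff.1 (Finset.mem_range.1 hk)
    rw [hneg, coeff_one_add_X_pow, Nat.choose_symm hk, mul_assoc]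
  have h2 : (1 - X : ℤ[X]) ^ n * (1 + X) ^ n = expand ℤ 2 ((1 - X) ^ n) := by
    rw [← mul_pow, map_pow, map_sub, map_one, expand_X]
    ring
  rw [h1, h2, coeff_expand two_pos, hneg]
  simp only [even_iff_two_dvd]

/-! ### Closed form of the Möbius function -/

/-- The Möbius function `μ((0, 0), (i, j))` of `Exponent`. -/
def moebiusBot : ℕ → ℕ → ℤ
  | 0, 0 => 1
  | 0, 1 => -1
  | 1, 0 => -1
  | 1, 1 => -1
  | i + 2, j + 2 => 2 * altChooseSum i j
  | _, _ => 0

theorem sum_moebiusBot_zero (n : ℕ) : ∑ j ∈ Finset.range (n + 1), moebiusBot 0 j =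
    -moebiusBot 0 (n + 1) := by
  cases n with
  | zero => simp [moebiusBot]
  | succ n => simp [Finset.sum_range_succ', moebiusBot]

theorem sum_moebiusBot_zero' (n : ℕ) : ∑ i ∈ Finset.range (n + 1), moebiusBot i 0 =
    -moebiusBot (n + 1) 0 := by
  cases n with
  | zero => simp [moebiusBot]
  | succ n => simp [Finset.sum_range_succ', moebiusBot]

/-- In the main case the entries with `i ≤ 1` or `j ≤ 1` add up to -2. The factor 2 in `moebiusBot`
makes this cancel the constant from `sum_altChooseSum`. -/
theorem sum_moebiusBot (m n : ℕ) :
    ∑ i ∈ Finset.range (m + 1), ∑ j ∈ Finset.range (n + 1), moebiusBot i j =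
      -moebiusBot (m + 1) (n + 1) := by
  rcases m with _ | m <;> rcases n with _ | n
  · simp [moebiusBot]
  · simp [Finset.sum_range_succ', moebiusBot]
  · simp [Finset.sum_range_succ', moebiusBot]
  · simp only [Finset.sum_range_succ', moebiusBot, Finset.sum_add_distrib, ← Finset.mul_sum,
      sum_altChooseSum]
    simp
    ring

/-! ### Chain counts in `P a b` -/

theorem Exponent.lt_iff {p q : Exponent} :
    p < q ↔ ((p.fst = 0 ∧ q.fst = 0) ∨ p.fst < q.fst) ∧
      ((p.snd = 0 ∧ q.snd = 0) ∨ p.snd < q.snd) ∧ p ≠ q := by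
  rw [lt_iff_le_and_ne, ← and_assoc]
  constructor
  · rintro ⟨rfl | h, hne⟩
    · exact absurd rfl hne
    · exact ⟨h, hne⟩
  · rintro ⟨h, hne⟩
    exact ⟨Or.inr h, hne⟩

open Classical in
theorem sum_lt_moebiusBot {a b : ℕ} [Fintype (P a b)] (q : P a b) (hq : q ≠ ⊥) :
    ∑ p ∈ Finset.univ.filter (fun p : P a b => p < q), moebiusBot p.1.fst p.1.snd =
      -moebiusBot q.1.fst q.1.snd := by
  obtain ⟨⟨i, j⟩, hq'⟩ := q
  have key : ∑ p ∈ Finset.univ.filter (fun p : P a b => p < ⟨⟨i, j⟩, hq'⟩),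
      moebiusBot p.1.fst p.1.snd =
      -- With truncated subtraction `i - 1 + 1` is `max i 1`: a zero coordinate of `q` still allows
      -- the value 0 below it.
      ∑ x ∈ Finset.range (i - 1 + 1) ×ˢ Finset.range (j - 1 + 1), moebiusBot x.1 x.2 := by
    have hne : ¬ (i = 0 ∧ j = 0) := by
      rintro ⟨rfl, rfl⟩
      exact hq rfl
    have hlt : ∀ k l : ℕ, (⟨k, l⟩ : Exponent) < ⟨i, j⟩ ↔
        k < i - 1 + 1 ∧ l < j - 1 + 1 := by
      intro k l
      rw [Exponent.lt_iff, ne_eq, Exponent.mk.injEq]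
      simp only
      omega
    refine Finset.sum_bij (fun p _ => (p.1.fst, p.1.snd)) ?_ ?_ ?_ ?_
    · intro p hp
      have hp : p.1 < ⟨i, j⟩ := (Finset.mem_filter.1 hp).2
      simpa using (hlt p.1.fst p.1.snd).1 hp
    · intro p _ p' _ h
      rw [Prod.mk.injEq] at h
      exact Subtype.ext (Exponent.ext h.1 h.2)
    · rintro ⟨k, l⟩ h
      have h : (⟨k, l⟩ : Exponent) < ⟨i, j⟩ := (hlt k l).2 (by simpa using h)
      exact ⟨⟨⟨k, l⟩, h.le.trans hq'⟩, Finset.mem_filter.2 ⟨Finset.mem_univ _, h⟩, rfl⟩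
    · intro p _
      rfl
  rw [key, Finset.sum_product]
  rcases i with _ | i <;> rcases j with _ | j
  · exact absurd rfl hq
  · simpa using sum_moebiusBot_zero j
  · simpa using sum_moebiusBot_zero' i
  · simpa using sum_moebiusBot i j

/-- Both sides satisfy the same recursion, with `moebiusBot 0 0 = 1` as the constant term. At `⊥`
they differ: the empty chain counts -1. -/
theorem openChainSum_eq_moebiusBot {a b : ℕ} [Fintype (P a b)] (q : P a b) (hq : q ≠ ⊥) :
    openChainSum q = moebiusBot q.1.fst q.1.snd := by
  classical
  induction q using WellFoundedLT.induction with
  | ind q ih =>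
    have hbot : (⊥ : P a b) ∈ Finset.univ.filter (fun p : P a b => p < q) := by
      simpa [bot_lt_iff_ne_bot] using hq
    have hsum := sum_lt_moebiusBot q hq
    rw [← Finset.add_sum_erase _ _ hbot] at hsum
    rw [openChainSum_eq, Finset.sum_congr
      (s₂ := (Finset.univ.filter (fun p : P a b => p < q)).erase ⊥) (by ext p; simp)
      fun p hp => ih p (Finset.mem_filter.1 (Finset.mem_of_mem_erase hp)).2
        (Finset.ne_of_mem_erase hp), ← neg_inj, ← hsum, neg_neg]
    rfl

theorem reducedEulerChar_P (n : ℕ) :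
    reducedEulerChar (P (n + 2) (n + 2)) = 2 * altChooseSum n n := by
  have := Fintype.ofFinite (P (n + 2) (n + 2))
  have htop : (⊤ : P (n + 2) (n + 2)) ≠ ⊥ := fun h => by
    have := congrArg (fun p => p.1.fst) h
    exact absurd this (Nat.succ_ne_zero _)
  rw [reducedEulerChar_eq_openChainSum, openChainSum_eq_moebiusBot _ htop]
  · rfl
  -- `(1, 1)` lies strictly between bottom and top because the exponents of the top are at least 2.
  · refine ⟨⟨⟨1, 1⟩, Or.inr ⟨Or.inr ?_, Or.inr ?_⟩⟩, fun h => ?_, fun h => ?_⟩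
    · simp
    · simp
    · have := congrArg (fun p => p.1.fst) h
      exact absurd this one_ne_zero
    · have := congrArg (fun p => p.1.fst) h
      simp only at this
      change 1 = n + 2 at this
      omega

end ProperDivision

theorem corollary4p1 (a : ℕ) (ha : 2 ≤ a) :
    (Odd a → ProperDivision.reducedEulerChar (ProperDivision.P a a) = 0) ∧
    (Even a → ProperDivision.reducedEulerChar (ProperDivision.P a a) =
      (-1 : ℤ) ^ ((a - 2) / 2) * (2 * ((a - 2).choose ((a - 2) / 2) : ℤ))) := by
  obtain ⟨n, rfl⟩ := Nat.exists_eq_add_of_le' ha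
  have hpar : Even (n + 2) ↔ Even n := by simp [Nat.even_add]
  rw [ProperDivision.reducedEulerChar_P, ProperDivision.altChooseSum_self, ← Nat.not_even_iff_odd, hpar,
    Nat.add_sub_cancel]
  constructor
  · intro h
    rw [if_neg h, mul_zero]
  · intro h
    rw [if_pos h]
    ring
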